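/- Let $n\ge 1$, $s\in(0,1)$, and let $\Omega\subset\mathbb{R}^n$ be a bounded open set with Lipschitz boundary. Put $$\mathcal G_s(t)=\int_0^t\int_0^\tau \frac{dr}{(1+r^2)^{\frac{n+1+s}{2}}}\,d\tau ,\qquad Q(\Omega)=\mathbb{R}^{2n}\setminus(\mathbb{R}^n\setminus\Omega)^2,\qquad \Omega_\delta=\{x\in\mathbb{R}^n : d(x,\Omega)-d(x,\mathbb{R}^n\setminus\Omega)<\delta\}\quad(\delta\in\mathbb{R}).$$ For $A\subset\Omega$ open, $\psi\in L^\infty(A)$ and $\varphi:\mathbb{R}^n\to\mathbb{R}$ measurable, let $\mathcal W^s_{\varphi,\psi}(\Omega,A)$ be the set of all $u:\mathbb{R}^n\to\mathbb{R}$ such that $u|_\Omega\in W^{s,1}(\Omega)$, i.e. $u|_\Omega\in L^1(\Omega)$ and $\int_\Omega\int_\Omega\frac{|u(x)-u(y)|}{|x-y|^{n+s}}\,dx\,dy<\infty$, $u=\varphi$ on $\mathbb{R}^n\setminus\Omega$, and $u\ge\psi$ a.e. in $A$. A function $u\in\mathcal W^s_{\varphi,\psi}(\Omega,A)$ solves the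 obstacle problem if $$\iint_{Q(\Omega)}\left\{\mathcal G_s\Big(\frac{u(x)-u(y)}{|x-y|}\Big)-\mathcal G_s\Big(\frac{v(x)-v(y)}{|x-y|}\Big)\right\}\frac{dx\,dy}{|x-y|^{n-1+s}}\le 0\qquad\text{for every } v\in\mathcal W^s_{\varphi,\psi}(\Omega,A).$$ Then there is a constant $\theta=\theta(n,s,\Omega)\in(0,1)$ such that the following holds for all such $A$, $\psi$, $\varphi$ and all $d>0$: if $u\in\mathcal W^s_{\varphi,\psi}(\Omega,A)$ solves the obstacle problem and $\varphi\in L^\infty(\Omega_d\setminus\Omega)$, then $u\in L^\infty(\Omega)$ and $$\|u\|_{L^\infty(\Omega\setminus\Omega_{-\theta d})}\le d+\max\big\{\|u\|_{L^\infty(\Omega_{-\theta d})},\ \|\psi\|_{L^\infty(A)},\ \|\varphi\|_{L^\infty(\Omega_d\setminus\Omega)}\big\}$$ (norms over an empty set are $0$). -/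

import Mathlib

open Set MeasureTheory
open scoped ENNReal

noncomputable section

namespace NonlocalObstacle

/-- Euclidean `n`-space. -/
abbrev E (n : ℕ) := EuclideanSpace ℝ (Fin n)

/-- `Ω` has Lipschitz boundary: near each of its boundary points, and for a suitable
direction `ν`, the set `Ω` is the strict subgraph in direction `ν` of a Lipschitz function
defined on the hyperplane orthogonal to `ν`. -/
def HasLipschitzBoundary {n : ℕ} (Ω : Set (E n)) : Prop :=
  ∀ p ∈ frontier Ω, ∃ (r : ℝ) (ν : E n) (γ : (ℝ ∙ ν)ᗮ → ℝ) (K : NNReal),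
    0 < r ∧ ‖ν‖ = 1 ∧ LipschitzWith K γ ∧
      ∀ x ∈ Metric.ball p r, x ∈ Ω ↔ inner ℝ ν x < γ ((ℝ ∙ ν)ᗮ.orthogonalProjectionOnto x)

/-- The signed distance from the boundary of `Ω`, negative inside `Ω`. -/
def signedDist {n : ℕ} (Ω : Set (E n)) (x : E n) : ℝ :=
  Metric.infDist x Ω - Metric.infDist x Ωᶜ

/-- The set `Ω_δ` of points whose signed distance is less than `δ`. -/
def nbhd {n : ℕ} (Ω : Set (E n)) (δ : ℝ) : Set (E n) :=
  {x | signedDist Ω x < δ}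

/-- `g_s(t) = (1 + t²)^{-(n+1+s)/2}`. -/
def gs (n : ℕ) (s t : ℝ) : ℝ :=
  1 / (1 + t ^ 2) ^ (((n : ℝ) + 1 + s) / 2)

/-- The first primitive `G_s` of `g_s`. -/
def Gs (n : ℕ) (s t : ℝ) : ℝ :=
  ∫ τ in (0 : ℝ)..t, gs n s τ

/-- The second primitive `𝒢_s` of `g_s`. -/
def GGs (n : ℕ) (s t : ℝ) : ℝ :=
  ∫ τ in (0 : ℝ)..t, Gs n s τ

/-- The integrand `𝒢_s((u(x) - u(y)) / |x - y|) / |x - y|^{n-1+s}` of the fractional area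
functional, as a function of the pair `(x, y)`. -/
def areaDensity {n : ℕ} (s : ℝ) (u : E n → ℝ) (p : E n × E n) : ℝ :=
  GGs n s ((u p.1 - u p.2) / ‖p.1 - p.2‖) / ‖p.1 - p.2‖ ^ ((n : ℝ) - 1 + s)

/-- `Q(Ω)`: the pairs of points that are not both outside `Ω`. -/
def Q {n : ℕ} (Ω : Set (E n)) : Set (E n × E n) :=
  (Ωᶜ ×ˢ Ωᶜ)ᶜ

/-- The Gagliardo seminorm `[u]_{W^{s,1}(Ω)}`, with values in `[0, ∞]`. -/
def gagliardo {n : ℕ} (s : ℝ) (Ω : Set (E n)) (u : E n → ℝ) : ℝ≥0∞ :=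
  ∫⁻ x in Ω, ∫⁻ y in Ω, ENNReal.ofReal (|u x - u y| / ‖x - y‖ ^ ((n : ℝ) + s))

/-- The space `𝒲^s(Ω)`: functions on the whole space whose restriction to `Ω` belongs to
`W^{s,1}(Ω)`. -/
def W {n : ℕ} (s : ℝ) (Ω : Set (E n)) : Set (E n → ℝ) :=
  {u | IntegrableOn u Ω volume ∧ gagliardo s Ω u < ⊤}

/-- The admissible class `𝒲^s_{φ,ψ}(Ω, A)`: functions in `𝒲^s(Ω)` that equal `φ` outside `Ω`
and lie above the obstacle `ψ` almost everywhere in `A`. -/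
def WObst {n : ℕ} (s : ℝ) (Ω A : Set (E n)) (φ ψ : E n → ℝ) : Set (E n → ℝ) :=
  {u | u ∈ W s Ω ∧ (∀ x ∈ Ωᶜ, u x = φ x) ∧ ∀ᵐ x ∂(volume.restrict A), ψ x ≤ u x}

/-- `u` solves the obstacle problem: it is admissible and, for every admissible `v`, the
integral over `Q(Ω)` of the difference of the area densities of `u` and `v` is at most zero.
The inequality `∫ f ≤ 0` is written `∫ f⁺ ≤ ∫ f⁻` in `[0, ∞]`, so that it does not rely on the
default value of the Bochner integral on functions that are not integrable. -/
def SolvesObstacle {n : ℕ} (s : ℝ) (Ω A : Set (E n)) (φ ψ u : E n → ℝ) : Prop :=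
  u ∈ WObst s Ω A φ ψ ∧
    ∀ v ∈ WObst s Ω A φ ψ,
      ∫⁻ p in Q Ω, ENNReal.ofReal (areaDensity s u p - areaDensity s v p) ≤
        ∫⁻ p in Q Ω, ENNReal.ofReal (areaDensity s v p - areaDensity s u p)

/-- The norm of `L^∞(S)`, with values in `[0, ∞]`. -/
def supNorm {n : ℕ} (u : E n → ℝ) (S : Set (E n)) : ℝ≥0∞ :=
  eLpNorm u ⊤ (volume.restrict S)

end NonlocalObstacle

end

/-!
Let `K = d + max {…}` be the right-hand side of the estimate. The competitor is the truncation
`v = min (u, K)` in `Ω`, `v = u` outside. It is admissible since `K` exceeds the obstacle, and it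
never increases the energy except through pairs `x ∈ Ω`, `y ∉ Ω` with `u x > K` and `u y > K`. As
`φ ≤ K - d` within distance `d` of `Ω`, these have `|x - y| ≥ d`, and since `𝒢_s` is Lipschitz the
cost is at most `C d^{-s}` times the excess `∫_Ω (u - K)⁺`.

Conversely, if `u x > K` and a set of measure at least `a ρ^n` in the ball of radius `ρ ≤ d` about
`x` carries values of `u` at most `K - d`, then on the corresponding pairs the slope
`(v x - v y) / |x - y|` is at least `1`. There `G_s ≥ G_s(1)`, so truncation gains at least
`G_s(1) a ρ^{-s}` per unit of excess at `x`. For `ρ = t d` with `t` small, depending only on `n`,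
`s` and `a`, the gain outweighs the cost (`exists_scale`). Minimality then forces the excess, which
is finite, to vanish (`ae_le_of_energy_le`).

The low values near `x` are found in two ways.
* In the layer `Ω \ Ω_{-θd}` they are the exterior data: the complement of a bounded Lipschitz
  domain contains, near each boundary point and at every scale, a ball of comparable radius
  (`exists_exterior_ball`). The proportion of the radii fixes `a`, hence `θ`, independently of `d`
  (`exists_layer_width`).
* For the boundedness of `u` in all of `Ω`, `K` is taken so large that `{u > K - d}` fills less
  than half of any ball of radius `t d`, which is possible since `u` is integrable (`exists_ae_le`).

Lower bounds follow by applying the same lemmas to `-u`: the energy is even, and truncation from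
below raises `u`, so it respects the obstacle. For this reason the lemmas on upper bounds assume
only minimality against the function's own truncations (`TruncMinimal`).
-/

namespace NonlocalObstacle

/-! ### The functions `g_s`, `G_s` and `𝒢_s` -/

lemma continuous_gs (n : ℕ) (s : ℝ) : Continuous (gs n s) := by
  unfold gs
  refine continuous_const.div (Continuous.rpow_const (by fun_prop) fun t => ?_) fun t => ?_
  · exact Or.inl (by positivity)
  · positivity

lemma gs_pos (n : ℕ) (s t : ℝ) : 0 < gs n s t := by
  unfold gs; positivity

lemma gs_le {n : ℕ} (hn : 1 ≤ n) {s : ℝ} (hs : 0 < s) (t : ℝ) : gs n s t ≤ (1 + t ^ 2)⁻¹ := by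
  have hn' : (1 : ℝ) ≤ n := by exact_mod_cast hn
  have h1 : (1 : ℝ) ≤ 1 + t ^ 2 := by nlinarith [sq_nonneg t]
  rw [gs, one_div]
  refine inv_anti₀ (by positivity) ?_
  calc 1 + t ^ 2 = (1 + t ^ 2) ^ (1 : ℝ) := (Real.rpow_one _).symm
    _ ≤ _ := Real.rpow_le_rpow_of_exponent_le h1 (by linarith)

lemma Gs_sub (n : ℕ) (s a b : ℝ) : Gs n s b - Gs n s a = ∫ τ in a..b, gs n s τ :=
  intervalIntegral.integral_interval_sub_left
    ((continuous_gs n s).intervalIntegrable _ _) ((continuous_gs n s).intervalIntegrable _ _)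

lemma Gs_zero (n : ℕ) (s : ℝ) : Gs n s 0 = 0 := by simp [Gs]

lemma Gs_strictMono (n : ℕ) (s : ℝ) : StrictMono (Gs n s) := by
  intro a b hab
  rw [← sub_pos, Gs_sub]
  exact intervalIntegral.intervalIntegral_pos_of_pos
    ((continuous_gs n s).intervalIntegrable _ _) (gs_pos n s) hab

lemma Gs_one_pos (n : ℕ) (s : ℝ) : 0 < Gs n s 1 := by
  simpa [Gs_zero] using Gs_strictMono n s one_pos

lemma Gs_neg (n : ℕ) (s t : ℝ) : Gs n s (-t) = -Gs n s t := by
  have h := intervalIntegral.integral_comp_neg (f := gs n s) (a := 0) (b := t)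
  have h2 : ∀ x, gs n s (-x) = gs n s x := fun x => by simp [gs]
  simp only [h2, neg_zero] at h
  rw [Gs, Gs, h, intervalIntegral.integral_symm]

lemma continuous_Gs (n : ℕ) (s : ℝ) : Continuous (Gs n s) :=
  intervalIntegral.continuous_primitive (fun _ _ => (continuous_gs n s).intervalIntegrable _ _) 0

/-- The bound `|G_s| ≤ 2` comes from `g_s(t) ≤ 1 / (1 + t²)`, the derivative of `arctan`. -/
lemma abs_Gs_le {n : ℕ} (hn : 1 ≤ n) {s : ℝ} (hs : 0 < s) (t : ℝ) : |Gs n s t| ≤ 2 := by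
  have key : ∀ t : ℝ, 0 ≤ t → |Gs n s t| ≤ 2 := by
    intro t ht
    have h0 : 0 ≤ Gs n s t := by
      simpa [Gs_zero] using (Gs_strictMono n s).monotone ht
    rw [abs_of_nonneg h0]
    calc Gs n s t ≤ ∫ τ in (0 : ℝ)..t, (1 + τ ^ 2)⁻¹ := by
          refine intervalIntegral.integral_mono_on ht
            ((continuous_gs n s).intervalIntegrable _ _) ?_ fun x _ => gs_le hn hs x
          exact (Continuous.inv₀ (by fun_prop) fun x => by positivity).intervalIntegrable _ _
      _ = Real.arctan t := by simp
      _ ≤ 2 := by linarith [Real.arctan_lt_pi_div_two t, Real.pi_le_four]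
  rcases le_total 0 t with h | h
  · exact key t h
  · simpa [Gs_neg] using key (-t) (by linarith)

lemma GGs_sub (n : ℕ) (s a b : ℝ) : GGs n s b - GGs n s a = ∫ τ in a..b, Gs n s τ :=
  intervalIntegral.integral_interval_sub_left
    ((continuous_Gs n s).intervalIntegrable _ _) ((continuous_Gs n s).intervalIntegrable _ _)

lemma GGs_neg (n : ℕ) (s t : ℝ) : GGs n s (-t) = GGs n s t := by
  have h := intervalIntegral.integral_comp_neg (f := Gs n s) (a := 0) (b := t)
  simp only [Gs_neg, neg_zero, intervalIntegral.integral_neg] at h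
  rw [GGs, GGs, intervalIntegral.integral_symm, ← h, neg_neg]

lemma GGs_abs (n : ℕ) (s t : ℝ) : GGs n s |t| = GGs n s t := by
  rcases abs_choice t with h | h <;> rw [h]
  exact GGs_neg n s t

lemma mul_sub_le_GGs_sub (n : ℕ) (s : ℝ) {c a b : ℝ} (hc : c ≤ a) (hab : a ≤ b) :
    Gs n s c * (b - a) ≤ GGs n s b - GGs n s a := by
  rw [GGs_sub, mul_comm, ← smul_eq_mul, ← intervalIntegral.integral_const]
  refine intervalIntegral.integral_mono_on hab (by simp)
    ((continuous_Gs n s).intervalIntegrable _ _) fun x hx => ?_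
  exact (Gs_strictMono n s).monotone (hc.trans hx.1)

lemma GGs_le_of_abs_le (n : ℕ) (s : ℝ) {a b : ℝ} (h : |a| ≤ |b|) : GGs n s a ≤ GGs n s b := by
  rw [← GGs_abs n s a, ← GGs_abs n s b, ← sub_nonneg]
  simpa [Gs_zero] using mul_sub_le_GGs_sub n s (abs_nonneg a) h

lemma GGs_sub_le {n : ℕ} (hn : 1 ≤ n) {s : ℝ} (hs : 0 < s) (a b : ℝ) :
    GGs n s b - GGs n s a ≤ 2 * |b - a| := by
  rw [GGs_sub]
  refine (le_abs_self _).trans ?_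
  exact intervalIntegral.norm_integral_le_of_norm_le_const (f := Gs n s)
    fun x _ => abs_Gs_le hn hs x

variable {n : ℕ} {s : ℝ}

/-! ### The area density of a pair of points -/

lemma areaDensity_swap (s : ℝ) (u : E n → ℝ) (p : E n × E n) :
    areaDensity s u p.swap = areaDensity s u p := by
  rw [areaDensity, areaDensity, Prod.fst_swap, Prod.snd_swap, norm_sub_rev, ← neg_sub (u p.1),
    neg_div, GGs_neg]

lemma areaDensity_neg (s : ℝ) (u : E n → ℝ) (p : E n × E n) :
    areaDensity s (-u) p = areaDensity s u p := by
  rw [areaDensity, areaDensity, Pi.neg_apply, Pi.neg_apply, ← neg_sub', neg_div, GGs_neg]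

lemma areaDensity_le_of_abs_le (s : ℝ) {u v : E n → ℝ} {x y : E n}
    (h : |v x - v y| ≤ |u x - u y|) : areaDensity s v (x, y) ≤ areaDensity s u (x, y) := by
  simp only [areaDensity]
  refine div_le_div_of_nonneg_right (GGs_le_of_abs_le n s ?_) (by positivity)
  rw [abs_div, abs_div]
  exact div_le_div_of_nonneg_right h (abs_nonneg _)

lemma rpow_split {r : ℝ} (hr : 0 < r) (s : ℝ) :
    r ^ ((n : ℝ) + s) = r * r ^ ((n : ℝ) - 1 + s) := by
  rw [show (n : ℝ) + s = 1 + (n - 1 + s) by ring, Real.rpow_add hr, Real.rpow_one]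

/-- Steep pairs: if `v` lowers the value of `u` at `x` without going below `u y + |x - y|`,
the density decreases at a definite rate, since `G_s ≥ G_s(1)` on `[1, ∞)`. -/
lemma le_areaDensity_sub (s : ℝ) {u v : E n → ℝ} {x y : E n} (hxy : x ≠ y) (hy : v y = u y)
    (hx : v x ≤ u x) (h : ‖x - y‖ ≤ v x - v y) :
    Gs n s 1 * (u x - v x) / ‖x - y‖ ^ ((n : ℝ) + s) ≤
      areaDensity s u (x, y) - areaDensity s v (x, y) := by
  have hr : 0 < ‖x - y‖ := norm_pos_iff.2 (sub_ne_zero.2 hxy)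
  simp only [areaDensity]
  rw [rpow_split hr, ← div_div, ← sub_div]
  refine div_le_div_of_nonneg_right ?_ (by positivity)
  refine le_trans (le_of_eq ?_) (mul_sub_le_GGs_sub n s (c := 1) ((one_le_div hr).2 h)
    (div_le_div_of_nonneg_right (by linarith) hr.le))
  rw [← sub_div, mul_div_assoc, hy]
  ring_nf

lemma areaDensity_sub_le (hn : 1 ≤ n) {s : ℝ} (hs : 0 < s) {u v : E n → ℝ} {x y : E n}
    (hxy : x ≠ y) (hy : v y = u y) :
    areaDensity s v (x, y) - areaDensity s u (x, y) ≤
      2 * |u x - v x| / ‖x - y‖ ^ ((n : ℝ) + s) := by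
  have hr : 0 < ‖x - y‖ := norm_pos_iff.2 (sub_ne_zero.2 hxy)
  simp only [areaDensity]
  rw [rpow_split hr, ← div_div, ← sub_div]
  refine div_le_div_of_nonneg_right ?_ (by positivity)
  refine (GGs_sub_le hn hs _ _).trans (le_of_eq ?_)
  rw [← sub_div, abs_div, abs_of_pos hr, mul_div_assoc, hy, abs_sub_comm (u x)]
  ring_nf

/-! ### The tail of the kernel -/

/-- The mass `∫_{|z| ≥ d} |z|^{-n-s} dz` of the kernel away from the origin. -/
noncomputable def kernelTail (n : ℕ) (s d : ℝ) : ℝ≥0∞ :=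
  ∫⁻ z : E n, {z : E n | d ≤ ‖z‖}.indicator
    (fun z => ENNReal.ofReal (‖z‖ ^ ((n : ℝ) + s))⁻¹) z

lemma measurable_kernel (s d : ℝ) : Measurable ({z : E n | d ≤ ‖z‖}.indicator
    (fun z => ENNReal.ofReal (‖z‖ ^ ((n : ℝ) + s))⁻¹)) := by
  refine Measurable.indicator (by fun_prop) (measurableSet_le measurable_const measurable_norm)

lemma exists_kernelTail_le (n : ℕ) {s : ℝ} (hs : 0 < s) :
    ∃ C : ℝ, 0 < C ∧ ∀ d : ℝ, 0 < d → kernelTail n s d ≤ ENNReal.ofReal (C * d ^ (-s)) := by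
  set r : ℝ := n + s with hr
  have hr0 : 0 < r := by positivity
  let F : E n → ℝ := fun z => (1 + ‖z‖) ^ (-r)
  have hF : Integrable F :=
    integrable_one_add_norm (by rw [finrank_euclideanSpace_fin]; linarith)
  have hF0 : 0 ≤ ∫ z, F z := integral_nonneg fun z => by positivity
  refine ⟨2 ^ r * (1 + ∫ z, F z), by positivity, fun d hd => ?_⟩
  have hpt : ∀ z : E n, {z : E n | d ≤ ‖z‖}.indicator
      (fun z => ENNReal.ofReal (‖z‖ ^ r)⁻¹) z ≤
        ENNReal.ofReal (d ^ (-r) * 2 ^ r * F (d⁻¹ • z)) := by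
    intro z
    by_cases hz : z ∈ {z : E n | d ≤ ‖z‖}
    swap
    · rw [indicator_of_notMem hz]
      exact bot_le
    rw [indicator_of_mem hz]
    refine ENNReal.ofReal_le_ofReal ?_
    have hz' : d ≤ ‖z‖ := hz
    have hz0 : 0 < ‖z‖ := hd.trans_le hz'
    have h1 : 1 + ‖d⁻¹ • z‖ = (d + ‖z‖) / d := by
      rw [norm_smul, norm_inv, Real.norm_of_nonneg hd.le]; field_simp
    simp only [F]
    rw [h1, Real.rpow_neg hd.le, Real.rpow_neg (by positivity),
      Real.div_rpow (by positivity) hd.le, inv_div]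
    have hle : (d + ‖z‖) ^ r ≤ 2 ^ r * ‖z‖ ^ r := by
      rw [← Real.mul_rpow (by norm_num) hz0.le]
      exact Real.rpow_le_rpow (by positivity) (by linarith) hr0.le
    have hdr : 0 < d ^ r := by positivity
    have hzr : 0 < ‖z‖ ^ r := by positivity
    have hsr : 0 < (d + ‖z‖) ^ r := by positivity
    rw [show (d ^ r)⁻¹ * 2 ^ r * (d ^ r / (d + ‖z‖) ^ r) = 2 ^ r / (d + ‖z‖) ^ r by field_simp,
      inv_eq_one_div, div_le_div_iff₀ hzr hsr, one_mul]
    exact hle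
  have hint : Integrable fun z : E n => d ^ (-r) * 2 ^ r * F (d⁻¹ • z) :=
    (hF.comp_smul (inv_ne_zero hd.ne')).const_mul _
  calc kernelTail n s d ≤ ∫⁻ z : E n, ENNReal.ofReal (d ^ (-r) * 2 ^ r * F (d⁻¹ • z)) :=
        lintegral_mono hpt
    _ = ENNReal.ofReal (∫ z : E n, d ^ (-r) * 2 ^ r * F (d⁻¹ • z)) :=
        (ofReal_integral_eq_lintegral_ofReal hint
          (Filter.Eventually.of_forall fun z => by positivity)).symm
    _ ≤ ENNReal.ofReal (2 ^ r * (1 + ∫ z, F z) * d ^ (-s)) := by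
        refine ENNReal.ofReal_le_ofReal ?_
        rw [integral_const_mul, Measure.integral_comp_inv_smul, finrank_euclideanSpace_fin,
          smul_eq_mul, abs_of_pos (by positivity)]
        have : d ^ (-r) * d ^ n = d ^ (-s) := by
          rw [← Real.rpow_natCast, ← Real.rpow_add hd, hr]; ring_nf
        rw [show d ^ (-r) * 2 ^ r * (d ^ n * ∫ z, F z)
          = (d ^ (-r) * d ^ n) * 2 ^ r * ∫ z, F z by ring, this]
        have : 0 < d ^ (-s) * 2 ^ r := by positivity
        nlinarith

/-! ### Truncation from above and its effect on the energy -/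

open Classical in
/-- The competitor `min (u, K)` in `Ω`, extended by `u` outside `Ω`. -/
noncomputable def truncAbove (Ω : Set (E n)) (K : ℝ) (u : E n → ℝ) (x : E n) : ℝ :=
  if x ∈ Ω then min (u x) K else u x

lemma truncAbove_of_mem {Ω : Set (E n)} {K : ℝ} {u : E n → ℝ} {x : E n} (hx : x ∈ Ω) :
    truncAbove Ω K u x = min (u x) K := if_pos hx

lemma truncAbove_of_notMem {Ω : Set (E n)} {K : ℝ} {u : E n → ℝ} {x : E n} (hx : x ∉ Ω) :
    truncAbove Ω K u x = u x := if_neg hx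

lemma abs_truncAbove_sub_le {Ω : Set (E n)} {K : ℝ} {u : E n → ℝ} {x y : E n}
    (hx : x ∈ Ω) (hy : y ∈ Ω) :
    |truncAbove Ω K u x - truncAbove Ω K u y| ≤ |u x - u y| := by
  rw [truncAbove_of_mem hx, truncAbove_of_mem hy]
  simpa using abs_min_sub_min_le_max (u x) K (u y) K

/-- The part of `u` in `Ω` that truncation at height `K` removes. -/
noncomputable def excess (Ω : Set (E n)) (K : ℝ) (u : E n → ℝ) : E n → ℝ≥0∞ :=
  Ω.indicator fun x => ENNReal.ofReal (u x - K)

lemma excess_eq_zero_iff {Ω : Set (E n)} {K : ℝ} {u : E n → ℝ} {x : E n} :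
    excess Ω K u x = 0 ↔ (x ∈ Ω → u x ≤ K) := by
  simp [excess, indicator_apply_eq_zero]

/-- The pairs `p` whose second point is `ρ`-close to the first and carries a value of `u` at
least `d` below `K`. When `ρ ≤ d`, lowering `u p.1` to `K` keeps the slope between the two points
at least `1`, so such pairs lose a definite amount of energy under truncation. -/
def gainSet (K d ρ : ℝ) (u : E n → ℝ) : Set (E n × E n) :=
  {p | u p.2 ≤ K - d ∧ p.2 ∈ Metric.closedBall p.1 ρ}

/-- A lower bound for the energy that truncation at height `K` saves on the pair `p`, counted at
its first point. -/
noncomputable def gain (s : ℝ) (Ω : Set (E n)) (K d ρ : ℝ) (u : E n → ℝ) (p : E n × E n) : ℝ≥0∞ :=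
  excess Ω K u p.1 * (gainSet K d ρ u).indicator
    (fun _ => ENNReal.ofReal (Gs n s 1 / ρ ^ ((n : ℝ) + s))) p

/-- An upper bound for the energy that truncation at height `K` costs on the pair `p`, counted at
its first point: only far interactions cost, and these at rate at most `sup |G_s| ≤ 2`. -/
noncomputable def loss (s : ℝ) (Ω : Set (E n)) (K d : ℝ) (u : E n → ℝ) (p : E n × E n) : ℝ≥0∞ :=
  excess Ω K u p.1 * (2 * {z : E n | d ≤ ‖z‖}.indicator
    (fun z => ENNReal.ofReal (‖z‖ ^ ((n : ℝ) + s))⁻¹) (p.1 - p.2))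

/-- The positive part of the difference of the area densities of `u` and `v`, restricted to
`Q Ω` by an indicator so that it can be integrated over all pairs. -/
noncomputable def densityDrop (s : ℝ) (Ω : Set (E n)) (u v : E n → ℝ) : E n × E n → ℝ≥0∞ :=
  (Q Ω).indicator fun p => ENNReal.ofReal (areaDensity s u p - areaDensity s v p)

lemma mem_Q {Ω : Set (E n)} {p : E n × E n} : p ∈ Q Ω ↔ p.1 ∈ Ω ∨ p.2 ∈ Ω := by
  simp only [Q, mem_compl_iff, mem_prod]; tauto

lemma densityDrop_swap (s : ℝ) (Ω : Set (E n)) (u v : E n → ℝ) (p : E n × E n) :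
    densityDrop s Ω u v p.swap = densityDrop s Ω u v p := by
  have hQ : p.swap ∈ Q Ω ↔ p ∈ Q Ω := by rw [mem_Q, mem_Q]; exact or_comm
  by_cases h : p ∈ Q Ω
  · rw [densityDrop, indicator_of_mem h, indicator_of_mem (hQ.2 h), areaDensity_swap,
      areaDensity_swap]
  · rw [densityDrop, indicator_of_notMem h, indicator_of_notMem (mt hQ.1 h)]

lemma gain_le (hs : 0 < s) {Ω : Set (E n)} {K d ρ : ℝ} (hρ : 0 < ρ) (hρd : ρ ≤ d)
    (u : E n → ℝ) (p : E n × E n) :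
    gain s Ω K d ρ u p ≤ densityDrop s Ω u (truncAbove Ω K u) p := by
  obtain ⟨x, y⟩ := p
  by_cases h0 : excess Ω K u x = 0
  · simp [gain, h0]
  by_cases hp : (x, y) ∈ gainSet K d ρ u
  swap
  · simp [gain, hp]
  obtain ⟨hx, hux⟩ : x ∈ Ω ∧ K < u x := by simpa [excess_eq_zero_iff] using h0
  have hy : u y ≤ K - d := hp.1
  have hd : ‖x - y‖ ≤ ρ := by
    have := hp.2; rwa [Metric.mem_closedBall, dist_comm, dist_eq_norm] at this
  have hvx : truncAbove Ω K u x = K := by rw [truncAbove_of_mem hx, min_eq_right hux.le]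
  have hvy : truncAbove Ω K u y = u y := by
    by_cases h : y ∈ Ω
    · rw [truncAbove_of_mem h, min_eq_left (by linarith)]
    · exact truncAbove_of_notMem h
  have hxy : x ≠ y := by rintro rfl; linarith
  have hr : 0 < ‖x - y‖ := norm_pos_iff.2 (sub_ne_zero.2 hxy)
  rw [densityDrop, indicator_of_mem (mem_Q.2 (Or.inl hx)), gain, indicator_of_mem hp, excess,
    indicator_of_mem hx, ← ENNReal.ofReal_mul (by linarith)]
  refine ENNReal.ofReal_le_ofReal (le_trans ?_ (le_areaDensity_sub s hxy hvy (by linarith)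
    (by linarith)))
  rw [hvx, mul_comm (Gs n s 1), mul_div_assoc]
  have hK : 0 ≤ u x - K := by linarith
  have := (Gs_one_pos n s).le
  gcongr

/-- Of a pair and its mirror image at most one contributes to the gain, so both together are
still controlled by the symmetric density. -/
lemma gain_add_gain_swap_le (hs : 0 < s) {Ω : Set (E n)} {K d ρ : ℝ} (hρ : 0 < ρ) (hρd : ρ ≤ d)
    (u : E n → ℝ) (p : E n × E n) :
    gain s Ω K d ρ u p + gain s Ω K d ρ u p.swap ≤
      densityDrop s Ω u (truncAbove Ω K u) p := by
  by_cases h : p ∈ gainSet K d ρ u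
  · have : excess Ω K u p.2 = 0 := excess_eq_zero_iff.2 fun _ => by linarith [h.1]
    rw [show gain s Ω K d ρ u p.swap = 0 by simp [gain, this], add_zero]
    exact gain_le hs hρ hρd u p
  · rw [show gain s Ω K d ρ u p = 0 by simp [gain, h], zero_add, ← densityDrop_swap]
    exact gain_le hs hρ hρd u p.swap

/-- Truncation costs energy only on pairs `(x, y)` with `K < u x`, `x ∈ Ω` and `K < u y`, `y ∉ Ω`;
there `y` is at distance at least `d` from `Ω`, where nothing is known about the data. -/
lemma densityDrop_le_loss (hn : 1 ≤ n) (hs : 0 < s) {Ω : Set (E n)} {K d : ℝ} (hd : 0 < d)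
    {u : E n → ℝ} {x y : E n} (hx : x ∈ Ω) (hy : y ∉ Ω)
    (hout : y ∈ Ωᶜ → Metric.infDist y Ω < d → u y ≤ K - d) :
    densityDrop s Ω (truncAbove Ω K u) u (x, y) ≤ loss s Ω K d u (x, y) := by
  rw [densityDrop, indicator_of_mem (mem_Q.2 (Or.inl hx))]
  have hvy : truncAbove Ω K u y = u y := truncAbove_of_notMem hy
  rcases le_or_gt (u x) K with hux | hux
  · have hvx : truncAbove Ω K u x = u x := by rw [truncAbove_of_mem hx, min_eq_left hux]
    simp [areaDensity, hvx, hvy]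
  have hvx : truncAbove Ω K u x = K := by rw [truncAbove_of_mem hx, min_eq_right hux.le]
  rcases le_or_gt (u y) K with huy | huy
  · rw [ENNReal.ofReal_of_nonpos]
    · exact bot_le
    rw [sub_nonpos]
    apply areaDensity_le_of_abs_le
    rw [hvx, hvy, abs_of_nonneg (by linarith), abs_of_nonneg (by linarith)]
    linarith
  · have hfar : d ≤ ‖x - y‖ := by
      by_contra! h
      have h2 : Metric.infDist y Ω ≤ dist y x := Metric.infDist_le_dist_of_mem hx
      rw [dist_comm, dist_eq_norm] at h2
      linarith [hout hy (h2.trans_lt h)]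
    have hxy : x ≠ y := by rintro rfl; exact hy hx
    rw [loss, indicator_of_mem (show x - y ∈ {z : E n | d ≤ ‖z‖} from hfar), excess,
      indicator_of_mem hx]
    have hmul : ENNReal.ofReal (u x - K) * (2 * ENNReal.ofReal (‖x - y‖ ^ ((n : ℝ) + s))⁻¹) =
        ENNReal.ofReal ((u x - K) * (2 * (‖x - y‖ ^ ((n : ℝ) + s))⁻¹)) := by
      rw [ENNReal.ofReal_mul (by linarith), ENNReal.ofReal_mul zero_le_two, ENNReal.ofReal_ofNat]
    rw [hmul]
    refine ENNReal.ofReal_le_ofReal ((areaDensity_sub_le hn hs hxy hvy).trans (le_of_eq ?_))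
    rw [hvx, abs_of_pos (by linarith), div_eq_mul_inv]
    ring

lemma densityDrop_le_loss_add_loss_swap (hn : 1 ≤ n) (hs : 0 < s) {Ω : Set (E n)} {K d : ℝ}
    (hd : 0 < d) {u : E n → ℝ} {p : E n × E n}
    (h1 : p.1 ∈ Ωᶜ → Metric.infDist p.1 Ω < d → u p.1 ≤ K - d)
    (h2 : p.2 ∈ Ωᶜ → Metric.infDist p.2 Ω < d → u p.2 ≤ K - d) :
    densityDrop s Ω (truncAbove Ω K u) u p ≤ loss s Ω K d u p + loss s Ω K d u p.swap := by
  obtain ⟨x, y⟩ := p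
  by_cases hx : x ∈ Ω <;> by_cases hy : y ∈ Ω
  · rw [densityDrop, indicator_of_mem (mem_Q.2 (Or.inl hx)), ENNReal.ofReal_of_nonpos]
    · exact bot_le
    · exact sub_nonpos.2 (areaDensity_le_of_abs_le s (abs_truncAbove_sub_le hx hy))
  · exact (densityDrop_le_loss hn hs hd hx hy h2).trans le_self_add
  · rw [← densityDrop_swap]
    exact (densityDrop_le_loss hn hs hd hy hx h1).trans le_add_self
  · rw [densityDrop, indicator_of_notMem (by simp [mem_Q, hx, hy])]
    exact bot_le

/-! ### Integration of gain and loss -/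

lemma measurableSet_Q {Ω : Set (E n)} (hΩ : MeasurableSet Ω) : MeasurableSet (Q Ω) :=
  (hΩ.compl.prod hΩ.compl).compl

lemma measurable_excess {Ω : Set (E n)} (hΩ : MeasurableSet Ω) (K : ℝ) {u : E n → ℝ}
    (hu : Measurable u) : Measurable (excess Ω K u) :=
  Measurable.indicator (by fun_prop) hΩ

lemma measurableSet_gainSet (K d ρ : ℝ) {u : E n → ℝ} (hu : Measurable u) :
    MeasurableSet (gainSet K d ρ u) := by
  refine (measurableSet_le (hu.comp measurable_snd) measurable_const).inter ?_
  exact measurableSet_le (f := fun p : E n × E n => dist p.2 p.1) (by fun_prop) measurable_const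

lemma measurable_gain (s : ℝ) {Ω : Set (E n)} (hΩ : MeasurableSet Ω) (K d ρ : ℝ) {u : E n → ℝ}
    (hu : Measurable u) : Measurable (gain s Ω K d ρ u) :=
  ((measurable_excess hΩ K hu).comp measurable_fst).mul
    (measurable_const.indicator (measurableSet_gainSet K d ρ hu))

lemma measurable_loss (s : ℝ) {Ω : Set (E n)} (hΩ : MeasurableSet Ω) (K d : ℝ) {u : E n → ℝ}
    (hu : Measurable u) : Measurable (loss s Ω K d u) :=
  ((measurable_excess hΩ K hu).comp measurable_fst).mul
    (((measurable_kernel s d).comp (measurable_fst.sub measurable_snd)).const_mul _)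

lemma lintegral_add_swap {f : E n × E n → ℝ≥0∞} (hf : Measurable f) :
    ∫⁻ p, (f p + f p.swap) = 2 * ∫⁻ p, f p := by
  rw [lintegral_add_left hf, Measure.volume_eq_prod, lintegral_prod_swap, two_mul]

lemma lintegral_loss (s : ℝ) {Ω : Set (E n)} (hΩ : MeasurableSet Ω) (K d : ℝ) {u : E n → ℝ}
    (hu : Measurable u) :
    ∫⁻ p, loss s Ω K d u p = (∫⁻ x, excess Ω K u x) * (2 * kernelTail n s d) := by
  have hk := measurable_kernel (n := n) s d
  rw [Measure.volume_eq_prod, lintegral_prod _ (measurable_loss s hΩ K d hu).aemeasurable,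
    ← lintegral_mul_const _ (measurable_excess hΩ K hu)]
  refine lintegral_congr fun x => ?_
  have hk' : Measurable fun y : E n => {z : E n | d ≤ ‖z‖}.indicator
      (fun z => ENNReal.ofReal (‖z‖ ^ ((n : ℝ) + s))⁻¹) (x - y) :=
    hk.comp (by fun_prop : Measurable fun y : E n => x - y)
  simp only [loss]
  rw [lintegral_const_mul _ (hk'.const_mul _), lintegral_const_mul _ hk', kernelTail]
  congr 2
  exact lintegral_sub_left_eq_self _ x

lemma le_lintegral_gain (s : ℝ) {Ω : Set (E n)} (hΩ : MeasurableSet Ω) {K d ρ : ℝ}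
    {u : E n → ℝ} (hu : Measurable u) {m : ℝ≥0∞}
    (hm : ∀ᵐ x : E n, x ∈ Ω → K < u x →
      m ≤ volume (Metric.closedBall x ρ ∩ {y | u y ≤ K - d})) :
    (∫⁻ x, excess Ω K u x) * (ENNReal.ofReal (Gs n s 1 / ρ ^ ((n : ℝ) + s)) * m) ≤
      ∫⁻ p, gain s Ω K d ρ u p := by
  have hS := measurableSet_gainSet K d ρ hu
  rw [Measure.volume_eq_prod, lintegral_prod _ (measurable_gain s hΩ K d ρ hu).aemeasurable,
    ← lintegral_mul_const _ (measurable_excess hΩ K hu)]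
  refine lintegral_mono_ae ?_
  filter_upwards [hm] with x hx
  by_cases h0 : excess Ω K u x = 0
  · simp [h0]
  obtain ⟨hxΩ, hux⟩ : x ∈ Ω ∧ K < u x := by simpa [excess_eq_zero_iff] using h0
  have hsec : MeasurableSet (Metric.closedBall x ρ ∩ {y | u y ≤ K - d}) :=
    Metric.isClosed_closedBall.measurableSet.inter (measurableSet_le hu measurable_const)
  have heq : ∀ y, (gainSet K d ρ u).indicator
      (fun _ => ENNReal.ofReal (Gs n s 1 / ρ ^ ((n : ℝ) + s))) (x, y) =
      (Metric.closedBall x ρ ∩ {y | u y ≤ K - d}).indicator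
      (fun _ => ENNReal.ofReal (Gs n s 1 / ρ ^ ((n : ℝ) + s))) y := by
    intro y
    have hiff : (x, y) ∈ gainSet K d ρ u ↔ y ∈ Metric.closedBall x ρ ∩ {y | u y ≤ K - d} :=
      and_comm
    by_cases h : (x, y) ∈ gainSet K d ρ u
    · rw [indicator_of_mem h, indicator_of_mem (hiff.1 h)]
    · rw [indicator_of_notMem h, indicator_of_notMem (mt hiff.2 h)]
  simp only [gain, heq]
  rw [lintegral_const_mul _ (measurable_const.indicator hsec), lintegral_indicator_const hsec]
  gcongr
  exact hx hxΩ hux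

/-- Both sides of the energy inequality are proportional to the total excess: the gain with a
factor at least `G_s(1) ρ^{-n-s} m`, the loss with the factor `2 * kernelTail n s d`. If the former
factor is larger, the excess vanishes. -/
lemma ae_le_of_energy_le_of_measurable (hn : 1 ≤ n) (hs : 0 < s) {Ω : Set (E n)}
    (hΩ : IsOpen Ω) (hΩf : volume Ω ≠ ⊤) {u : E n → ℝ} (hu : Measurable u)
    (hint : IntegrableOn u Ω) {K d ρ : ℝ} (hρ : 0 < ρ) (hρd : ρ ≤ d) {m : ℝ≥0∞}
    (hout : ∀ᵐ y : E n, y ∈ Ωᶜ → Metric.infDist y Ω < d → u y ≤ K - d)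
    (hm : ∀ᵐ x : E n, x ∈ Ω → K < u x →
      m ≤ volume (Metric.closedBall x ρ ∩ {y | u y ≤ K - d}))
    (hlt : 2 * kernelTail n s d < ENNReal.ofReal (Gs n s 1 / ρ ^ ((n : ℝ) + s)) * m)
    (henergy : ∫⁻ p, densityDrop s Ω u (truncAbove Ω K u) p ≤
      ∫⁻ p, densityDrop s Ω (truncAbove Ω K u) u p) :
    ∀ᵐ x : E n, x ∈ Ω → u x ≤ K := by
  have hΩm := hΩ.measurableSet
  have hJ : ∫⁻ x, excess Ω K u x ≠ ⊤ := by
    unfold excess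
    rw [lintegral_indicator hΩm]
    have : IntegrableOn (fun x => u x - K) Ω := hint.sub (integrableOn_const hΩf)
    exact (this.lintegral_lt_top).ne
  have hloss : ∫⁻ p, densityDrop s Ω (truncAbove Ω K u) u p ≤
      2 * ∫⁻ p, loss s Ω K d u p := by
    rw [← lintegral_add_swap (measurable_loss s hΩm K d hu)]
    refine lintegral_mono_ae ?_
    filter_upwards [Measure.quasiMeasurePreserving_fst.ae hout,
      Measure.quasiMeasurePreserving_snd.ae hout] with p h1 h2
    exact densityDrop_le_loss_add_loss_swap hn hs (hρ.trans_le hρd) h1 h2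
  have hgain : 2 * ∫⁻ p, gain s Ω K d ρ u p ≤
      ∫⁻ p, densityDrop s Ω u (truncAbove Ω K u) p := by
    rw [← lintegral_add_swap (measurable_gain s hΩm K d ρ hu)]
    exact lintegral_mono fun p => gain_add_gain_swap_le hs hρ hρd u p
  have h := (hgain.trans henergy).trans hloss
  rw [ENNReal.mul_le_mul_iff_right two_ne_zero ENNReal.ofNat_ne_top,
    lintegral_loss s hΩm K d hu] at h
  have h' := (le_lintegral_gain s hΩm hu hm).trans h
  -- a positive excess could be cancelled, against the strict inequality `hlt`
  have hJ0 : ∫⁻ x, excess Ω K u x = 0 := by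
    by_contra hne
    exact absurd ((ENNReal.mul_le_mul_iff_right hne hJ).1 h') (not_le.2 hlt)
  rw [lintegral_eq_zero_iff (measurable_excess hΩm K hu)] at hJ0
  filter_upwards [hJ0] with x hx
  exact excess_eq_zero_iff.1 hx

lemma densityDrop_congr_ae (s : ℝ) (Ω : Set (E n)) {u u' v v' : E n → ℝ}
    (hu : ∀ᵐ x, u x = u' x) (hv : ∀ᵐ x, v x = v' x) :
    ∫⁻ p, densityDrop s Ω u v p = ∫⁻ p, densityDrop s Ω u' v' p := by
  refine lintegral_congr_ae ?_
  filter_upwards [Measure.quasiMeasurePreserving_fst.ae hu,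
    Measure.quasiMeasurePreserving_snd.ae hu, Measure.quasiMeasurePreserving_fst.ae hv,
    Measure.quasiMeasurePreserving_snd.ae hv] with p h1 h2 h3 h4
  simp only [densityDrop, indicator, areaDensity, h1, h2, h3, h4]

lemma ae_le_of_energy_le (hn : 1 ≤ n) (hs : 0 < s) {Ω : Set (E n)}
    (hΩ : IsOpen Ω) (hΩf : volume Ω ≠ ⊤) {u : E n → ℝ} (hu : AEMeasurable u)
    (hint : IntegrableOn u Ω) {K d ρ : ℝ} (hρ : 0 < ρ) (hρd : ρ ≤ d) {m : ℝ≥0∞}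
    (hout : ∀ᵐ y : E n, y ∈ Ωᶜ → Metric.infDist y Ω < d → u y ≤ K - d)
    (hm : ∀ᵐ x : E n, x ∈ Ω → K < u x →
      m ≤ volume (Metric.closedBall x ρ ∩ {y | u y ≤ K - d}))
    (hlt : 2 * kernelTail n s d < ENNReal.ofReal (Gs n s 1 / ρ ^ ((n : ℝ) + s)) * m)
    (henergy : ∫⁻ p, densityDrop s Ω u (truncAbove Ω K u) p ≤
      ∫⁻ p, densityDrop s Ω (truncAbove Ω K u) u p) :
    ∀ᵐ x : E n, x ∈ Ω → u x ≤ K := by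
  have hae : ∀ᵐ x, u x = hu.mk u x := hu.ae_eq_mk
  have htr : ∀ᵐ x, truncAbove Ω K u x = truncAbove Ω K (hu.mk u) x := by
    filter_upwards [hae] with x hx
    simp only [truncAbove, hx]
  have key := ae_le_of_energy_le_of_measurable hn hs hΩ hΩf hu.measurable_mk
    (hint.congr (ae_restrict_of_ae hae)) (K := K) (m := m) hρ hρd ?_ ?_ hlt ?_
  · filter_upwards [key, hae] with x hx h
    rwa [h]
  · filter_upwards [hout, hae] with x hx h
    rwa [← h]
  · filter_upwards [hm, hae] with x hx h hxΩ hK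
    refine (hx hxΩ (by rwa [h])).trans (le_of_eq (measure_congr ?_))
    refine (Filter.EventuallyEq.refl _ _).inter ?_
    filter_upwards [hae] with y hy
    exact propext (show u y ≤ K - d ↔ hu.mk u y ≤ K - d by rw [hy])
  · rwa [← densityDrop_congr_ae s Ω hae htr, ← densityDrop_congr_ae s Ω htr hae]

/-! ### Exterior balls of Lipschitz domains -/

/-- Near a boundary point a Lipschitz domain has exterior cones of a fixed opening, hence
exterior balls of radius proportional to the scale. -/
lemma exists_exterior_ball_near {Ω : Set (E n)} (hΩ : IsOpen Ω) (hΩL : HasLipschitzBoundary Ω)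
    {p : E n} (hp : p ∈ frontier Ω) :
    ∃ κ r₀ : ℝ, 0 < κ ∧ 0 < r₀ ∧ ∀ z ∈ Metric.ball p r₀, z ∈ frontier Ω → ∀ r, 0 < r → r ≤ r₀ →
      ∃ w, Metric.ball w (κ * r) ⊆ Metric.ball z r \ Ω := by
  obtain ⟨R, ν, γ, K, hR, hν, hγ, hiff⟩ := hΩL p hp
  have hK : (0 : ℝ) ≤ K := K.2
  -- An error `e` at the centre `z + (r / 2) ν` costs `(1 + K) ‖e‖` of the height `r / 2` above the
  -- graph; `2 + K` instead of `1 + K` keeps the ball inside `ball z r` as well.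
  refine ⟨1 / (2 * (2 + K)), R / 2, by positivity, by positivity, fun z hz hzf r hr hrR =>
    ⟨z + (r / 2) • ν, fun y hy => ?_⟩⟩
  have hzΩ : z ∉ Ω := fun h => by
    rw [hΩ.frontier_eq] at hzf; exact hzf.2 h
  set e : E n := y - (z + (r / 2) • ν) with he
  have hye : y = z + (r / 2) • ν + e := by rw [he]; abel
  have hek : ‖e‖ < 1 / (2 * (2 + K)) * r := by rwa [Metric.mem_ball, dist_eq_norm] at hy
  have hek' : (2 + K) * ‖e‖ < r / 2 := by
    have h2 : (0 : ℝ) < 2 + K := by positivity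
    calc (2 + K) * ‖e‖ < (2 + K) * (1 / (2 * (2 + K)) * r) := by gcongr
      _ = r / 2 := by field_simp
  have hzy : dist y z < r := by
    rw [dist_eq_norm, hye, show z + (r / 2) • ν + e - z = (r / 2) • ν + e by abel]
    refine (norm_add_le _ _).trans_lt ?_
    rw [norm_smul, hν, Real.norm_of_nonneg (by positivity)]
    nlinarith [norm_nonneg e, mul_nonneg hK (norm_nonneg e)]
  have hzb : z ∈ Metric.ball p R := Metric.ball_subset_ball (by linarith) hz
  have hyb : y ∈ Metric.ball p R := by
    rw [Metric.mem_ball] at hz ⊢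
    linarith [dist_triangle y z p]
  refine ⟨hzy, fun hyΩ => ?_⟩
  have h1 : γ ((ℝ ∙ ν)ᗮ.orthogonalProjectionOnto z) ≤ inner ℝ ν z :=
    not_lt.1 (mt (hiff z hzb).2 hzΩ)
  have h2 := (hiff y hyb).1 hyΩ
  have hin : inner ℝ ν y = inner ℝ ν z + r / 2 + inner ℝ ν e := by
    rw [hye, inner_add_right, inner_add_right, inner_smul_right, real_inner_self_eq_norm_sq, hν]
    ring
  have hpr : (ℝ ∙ ν)ᗮ.orthogonalProjectionOnto y =
      (ℝ ∙ ν)ᗮ.orthogonalProjectionOnto z + (ℝ ∙ ν)ᗮ.orthogonalProjectionOnto e := by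
    rw [hye, map_add, map_add, map_smul,
      Submodule.orthogonalProjectionOnto_orthogonalComplement_singleton_eq_zero, smul_zero,
      add_zero]
  have h3 := hγ.dist_le_mul ((ℝ ∙ ν)ᗮ.orthogonalProjectionOnto y)
    ((ℝ ∙ ν)ᗮ.orthogonalProjectionOnto z)
  rw [Real.dist_eq, dist_eq_norm, hpr, add_sub_cancel_left, ← hpr] at h3
  have h4 := Submodule.norm_orthogonalProjectionOnto_apply_le (ℝ ∙ ν)ᗮ e
  have h5 : |inner ℝ ν e| ≤ ‖ν‖ * ‖e‖ := abs_real_inner_le_norm ν e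
  rw [hν, one_mul] at h5
  have h6 := mul_le_mul_of_nonneg_left h4 hK
  linarith [(abs_le.1 h5).1, (abs_le.1 h3).2, norm_nonneg e]

/-- The exterior ball property at all scales: small scales by the local graphs, large ones since
`Ω` is bounded, intermediate ones by using a smaller ball; compactness of the boundary makes
the constant uniform. -/
lemma exists_exterior_ball (hn : 1 ≤ n) {Ω : Set (E n)} (hΩ : IsOpen Ω)
    (hΩb : Bornology.IsBounded Ω) (hΩL : HasLipschitzBoundary Ω) :
    ∃ κ : ℝ, 0 < κ ∧ ∀ z ∈ frontier Ω, ∀ r, 0 < r →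
      ∃ w, Metric.ball w (κ * r) ⊆ Metric.ball z r \ Ω := by
  have : Nonempty (Fin n) := ⟨⟨0, hn⟩⟩
  obtain ⟨R', hR'⟩ := hΩb.closure.subset_closedBall (0 : E n)
  set R : ℝ := max R' 1
  have hR : 0 < R := lt_max_of_lt_right one_pos
  have hcl : closure Ω ⊆ Metric.closedBall 0 R :=
    hR'.trans (Metric.closedBall_subset_closedBall (le_max_left _ _))
  obtain ⟨e, he⟩ : ∃ e : E n, ‖e‖ = 1 := exists_norm_eq (E n) zero_le_one
  have hlarge : ∀ z ∈ frontier Ω, ∀ r, 8 * R ≤ r →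
      Metric.ball (z + (r / 2) • e) (1 / 4 * r) ⊆ Metric.ball z r \ Ω := by
    intro z hz r hr y hy
    have hc : dist (z + (r / 2) • e) z = r / 2 := by
      rw [dist_eq_norm, add_sub_cancel_left, norm_smul, he,
        Real.norm_of_nonneg (by linarith), mul_one]
    rw [Metric.mem_ball] at hy
    refine ⟨?_, fun hyΩ => ?_⟩
    · rw [Metric.mem_ball]
      linarith [dist_triangle y (z + (r / 2) • e) z]
    · have h1 : dist y 0 ≤ R := hcl (subset_closure hyΩ)
      have h2 : dist z 0 ≤ R := hcl (frontier_subset_closure hz)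
      have h3 := dist_triangle (z + (r / 2) • e) y z
      have h4 := dist_triangle_right y z 0
      rw [dist_comm (z + (r / 2) • e) y] at h3
      linarith
  have hcpt : IsCompact (frontier Ω) :=
    (hΩb.closure.subset frontier_subset_closure).isCompact_closure.of_isClosed_subset
      isClosed_frontier subset_closure
  refine hcpt.induction_on
    (p := fun S => ∃ κ : ℝ, 0 < κ ∧ ∀ z ∈ S, ∀ r, 0 < r →
      ∃ w, Metric.ball w (κ * r) ⊆ Metric.ball z r \ Ω) ⟨1, one_pos, by simp⟩ ?_ ?_ ?_
  · rintro S T hST ⟨κ, hκ, h⟩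
    exact ⟨κ, hκ, fun z hz => h z (hST hz)⟩
  · rintro S T ⟨κ, hκ, h⟩ ⟨κ', hκ', h'⟩
    refine ⟨min κ κ', lt_min hκ hκ', ?_⟩
    rintro z (hz | hz) r hr
    · obtain ⟨w, hw⟩ := h z hz r hr
      exact ⟨w, (Metric.ball_subset_ball (by gcongr; exact min_le_left _ _)).trans hw⟩
    · obtain ⟨w, hw⟩ := h' z hz r hr
      exact ⟨w, (Metric.ball_subset_ball (by gcongr; exact min_le_right _ _)).trans hw⟩
  · intro p hp
    obtain ⟨κ, r₀, hκ, hr₀, h⟩ := exists_exterior_ball_near hΩ hΩL hp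
    refine ⟨Metric.ball p r₀ ∩ frontier Ω,
      Filter.inter_mem (mem_nhdsWithin_of_mem_nhds (Metric.ball_mem_nhds p hr₀))
        self_mem_nhdsWithin, min (1 / 4) (κ * min 1 (r₀ / (8 * R))), by positivity, ?_⟩
    rintro z ⟨hz, hzf⟩ r hr
    rcases le_or_gt r r₀ with h1 | h1
    · obtain ⟨w, hw⟩ := h z hz hzf r hr h1
      refine ⟨w, (Metric.ball_subset_ball ?_).trans hw⟩
      gcongr
      exact (min_le_right _ _).trans (mul_le_of_le_one_right hκ.le (min_le_left _ _))
    rcases le_or_gt (8 * R) r with h2 | h2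
    · refine ⟨_, (Metric.ball_subset_ball ?_).trans (hlarge z hzf r h2)⟩
      gcongr
      exact min_le_left _ _
    · obtain ⟨w, hw⟩ := h z hz hzf r₀ hr₀ le_rfl
      refine ⟨w, (Metric.ball_subset_ball ?_).trans
        (hw.trans (sdiff_subset_sdiff_left (Metric.ball_subset_ball h1.le)))⟩
      calc min (1 / 4) (κ * min 1 (r₀ / (8 * R))) * r
          ≤ κ * (r₀ / (8 * R)) * (8 * R) := by
            gcongr
            exact (min_le_right _ _).trans (by gcongr; exact min_le_right _ _)
        _ = κ * r₀ := by field_simp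

/-! ### Upper bounds for functions minimal against truncation -/

/-- The scaling that decides the argument: a set of density `a` at scale `t * d` outweighs the
tail of the kernel beyond `d` as soon as `t` is small, by the factor `t ^ (-s)`. -/
lemma exists_scale (n : ℕ) (hs : 0 < s) {a : ℝ} (ha : 0 < a) :
    ∃ t : ℝ, 0 < t ∧ t < 1 ∧ ∀ d : ℝ, 0 < d → 2 * kernelTail n s d <
      ENNReal.ofReal (Gs n s 1 / (t * d) ^ ((n : ℝ) + s)) * ENNReal.ofReal (a * (t * d) ^ n) := by
  obtain ⟨C, hC, hT⟩ := exists_kernelTail_le n hs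
  have hG := Gs_one_pos n s
  set b : ℝ := Gs n s 1 * a / (4 * C) with hb
  have hb0 : 0 < b := by positivity
  refine ⟨min (1 / 2) (b ^ s⁻¹), by positivity, (min_le_left _ _).trans_lt (by norm_num),
    fun d hd => ?_⟩
  set t : ℝ := min (1 / 2) (b ^ s⁻¹)
  have ht : 0 < t := by positivity
  have htb : t ^ s ≤ b := by
    calc t ^ s ≤ (b ^ s⁻¹) ^ s := Real.rpow_le_rpow ht.le (min_le_right _ _) hs.le
      _ = b := Real.rpow_inv_rpow hb0.le hs.ne'
  have htd : 0 < t * d := by positivity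
  rw [← ENNReal.ofReal_mul (by positivity)]
  have heq : Gs n s 1 / (t * d) ^ ((n : ℝ) + s) * (a * (t * d) ^ n) =
      Gs n s 1 * a / (t ^ s * d ^ s) := by
    rw [Real.rpow_add htd, Real.rpow_natCast, Real.mul_rpow ht.le hd.le]
    field_simp
  rw [heq]
  calc 2 * kernelTail n s d ≤ 2 * ENNReal.ofReal (C * d ^ (-s)) := by gcongr; exact hT d hd
    _ = ENNReal.ofReal (2 * (C * d ^ (-s))) := by
      rw [ENNReal.ofReal_mul zero_le_two, ENNReal.ofReal_ofNat]
    _ < _ := by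
      have hts : 0 < t ^ s := by positivity
      have hds : 0 < d ^ s := by positivity
      have hnum : 2 * C * t ^ s < Gs n s 1 * a := by
        have h4 : 4 * C * b = Gs n s 1 * a := by rw [hb]; field_simp
        have h5 : 0 < C * b := by positivity
        nlinarith [mul_le_mul_of_nonneg_left htb hC.le]
      refine (ENNReal.ofReal_lt_ofReal_iff (by positivity)).2 ?_
      rw [Real.rpow_neg hd.le, lt_div_iff₀ (by positivity)]
      calc 2 * (C * (d ^ s)⁻¹) * (t ^ s * d ^ s) = 2 * C * t ^ s := by field_simp
        _ < _ := hnum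

/-- The volume of the unit ball of `E n`. -/
noncomputable def unitVol (n : ℕ) : ℝ := (volume (Metric.ball (0 : E n) 1)).toReal

lemma unitVol_pos (n : ℕ) : 0 < unitVol n :=
  ENNReal.toReal_pos (Metric.measure_ball_pos _ _ one_pos).ne' measure_ball_lt_top.ne

lemma volume_ball_eq (x : E n) {r : ℝ} (hr : 0 < r) :
    volume (Metric.ball x r) = ENNReal.ofReal (unitVol n * r ^ n) := by
  rw [Measure.addHaar_ball_of_pos _ _ hr, finrank_euclideanSpace_fin, mul_comm (unitVol n),
    ENNReal.ofReal_mul (by positivity), unitVol, ENNReal.ofReal_toReal measure_ball_lt_top.ne]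

lemma exists_volume_superlevel_le {Ω : Set (E n)} {u : E n → ℝ} (hint : IntegrableOn u Ω)
    {ε : ℝ≥0∞} (hε : ε ≠ 0) (hε' : ε ≠ ⊤) :
    ∃ T : ℝ, ∀ K, T ≤ K → volume (Ω ∩ {x | K < u x}) ≤ ε := by
  have hI : ∫⁻ x in Ω, ‖u x‖ₑ ≠ ⊤ := hint.2.ne
  have hIε := ENNReal.div_ne_top hI hε
  -- Markov's inequality; the summand `1` makes the threshold positive.
  refine ⟨((∫⁻ x in Ω, ‖u x‖ₑ) / ε).toReal + 1, fun K hK => ?_⟩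
  have hK0 : 0 < K := by
    have : 0 ≤ ((∫⁻ x in Ω, ‖u x‖ₑ) / ε).toReal := ENNReal.toReal_nonneg
    linarith
  have hsub : Ω ∩ {x | K < u x} ⊆ {x | ENNReal.ofReal K ≤ ‖u x‖ₑ} ∩ Ω := by
    rintro x ⟨hx, hKx⟩
    refine ⟨?_, hx⟩
    change ENNReal.ofReal K ≤ ‖u x‖ₑ
    rw [Real.enorm_eq_ofReal_abs]
    exact ENNReal.ofReal_le_ofReal ((le_of_lt hKx).trans (le_abs_self _))
  calc volume (Ω ∩ {x | K < u x})
      ≤ volume.restrict Ω {x | ENNReal.ofReal K ≤ ‖u x‖ₑ} :=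
        (measure_mono hsub).trans (Measure.le_restrict_apply _ _)
    _ ≤ (∫⁻ x in Ω, ‖u x‖ₑ) / ENNReal.ofReal K :=
        meas_ge_le_lintegral_div hint.1.enorm (by simpa using hK0) ENNReal.ofReal_ne_top
    _ ≤ ε := by
        refine ENNReal.div_le_of_le_mul ?_
        rw [mul_comm, ← ENNReal.div_le_iff hε hε', ← ENNReal.ofReal_toReal hIε]
        exact ENNReal.ofReal_le_ofReal (by linarith)

/-- Minimality of `u` against its own truncation at height `K`. -/
def TruncMinimal (s : ℝ) (Ω : Set (E n)) (K : ℝ) (u : E n → ℝ) : Prop :=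
  ∫⁻ p, densityDrop s Ω u (truncAbove Ω K u) p ≤ ∫⁻ p, densityDrop s Ω (truncAbove Ω K u) u p

/-- Boundedness from above in all of `Ω`: since `u` is integrable, its high superlevel sets have
small measure, so every ball of a fixed small radius `ρ < d` about a point of `Ω` is half
filled with low values, which gains more energy than the data beyond distance `d` cost. -/
lemma exists_ae_le (hn : 1 ≤ n) (hs : 0 < s) {Ω : Set (E n)} (hΩ : IsOpen Ω)
    (hΩf : volume Ω ≠ ⊤) {u : E n → ℝ} (hu : AEMeasurable u) (hint : IntegrableOn u Ω)
    {d N K₀ : ℝ} (hd : 0 < d)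
    (hout : ∀ᵐ y : E n, y ∈ Ωᶜ → Metric.infDist y Ω < d → u y ≤ N)
    (hmin : ∀ K, K₀ ≤ K → TruncMinimal s Ω K u) :
    ∃ K, ∀ᵐ x : E n, x ∈ Ω → u x ≤ K := by
  have hω := unitVol_pos n
  obtain ⟨t, ht0, ht1, ht⟩ := exists_scale n hs (half_pos hω)
  set ρ : ℝ := t * d with hρ
  have hρ0 : 0 < ρ := by positivity
  have hρd : ρ < d := by nlinarith
  obtain ⟨T, hT⟩ := exists_volume_superlevel_le hint
    (ε := ENNReal.ofReal (unitVol n / 2 * ρ ^ n))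
    (ENNReal.ofReal_pos.2 (by positivity)).ne' ENNReal.ofReal_ne_top
  refine ⟨max K₀ (max N T + d), ?_⟩
  set K : ℝ := max K₀ (max N T + d)
  have hKd : max N T + d ≤ K := le_max_right _ _
  have hN : N ≤ K - d := by linarith [le_max_left N T]
  have hTK : T ≤ K - d := by linarith [le_max_right N T]
  refine ae_le_of_energy_le hn hs hΩ hΩf hu hint hρ0 hρd.le ?_ ?_ (ht d hd)
    (hmin K (le_max_left _ _))
  · filter_upwards [hout] with y hy h1 h2 using (hy h1 h2).trans hN
  · refine Filter.Eventually.of_forall fun x hx _ => ?_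
    set B := Ω ∩ {y | K - d < u y}
    calc ENNReal.ofReal (unitVol n / 2 * ρ ^ n)
        = ENNReal.ofReal (unitVol n * ρ ^ n) - ENNReal.ofReal (unitVol n / 2 * ρ ^ n) := by
          rw [← ENNReal.ofReal_sub _ (by positivity)]
          congr 1; ring
      _ ≤ volume (Metric.closedBall x ρ) - volume B := by
          rw [← volume_ball_eq x hρ0]
          exact tsub_le_tsub (measure_mono Metric.ball_subset_closedBall) (hT _ hTK)
      _ ≤ volume (Metric.closedBall x ρ \ B) := le_measure_sdiff
      _ ≤ volume (Metric.closedBall x ρ ∩ {y | u y ≤ K - d}) := by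
          refine measure_mono_ae ?_
          filter_upwards [hout] with y hy hyB
          refine ⟨hyB.1, ?_⟩
          change u y ≤ K - d
          by_cases hyΩ : y ∈ Ω
          · exact not_lt.1 fun h => hyB.2 ⟨hyΩ, h⟩
          · refine (hy hyΩ ((Metric.infDist_le_dist_of_mem hx).trans_lt ?_)).trans hN
            exact (Metric.mem_closedBall.1 hyB.1).trans_lt hρd

lemma continuous_signedDist (Ω : Set (E n)) : Continuous (signedDist Ω) :=
  (Metric.continuous_infDist_pt _).sub (Metric.continuous_infDist_pt _)

/-- Boundedness from above in the boundary layer: every point of the layer of width `θ * d` has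
an exterior ball of comparable size nearby, on which `u` lies at least `d` below `K`. -/
lemma exists_layer_width (hn : 1 ≤ n) (hs : 0 < s) {Ω : Set (E n)} (hΩ : IsOpen Ω)
    (hΩb : Bornology.IsBounded Ω) (hΩL : HasLipschitzBoundary Ω) :
    ∃ θ : ℝ, 0 < θ ∧ θ < 1 ∧ ∀ (d K : ℝ) (u : E n → ℝ), 0 < d → AEMeasurable u →
      IntegrableOn u Ω → (∀ᵐ y : E n, y ∈ Ωᶜ → Metric.infDist y Ω < d → u y ≤ K - d) →
      (∀ᵐ x : E n, x ∈ nbhd Ω (-(θ * d)) → u x ≤ K) → TruncMinimal s Ω K u →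
      ∀ᵐ x : E n, x ∈ Ω → u x ≤ K := by
  have : Nonempty (Fin n) := ⟨⟨0, hn⟩⟩
  have hω := unitVol_pos n
  obtain ⟨κ, hκ, hball⟩ := exists_exterior_ball hn hΩ hΩb hΩL
  obtain ⟨t, ht0, ht1, ht⟩ := exists_scale n hs (a := unitVol n * (κ / 2) ^ n) (by positivity)
  refine ⟨t / 2, by positivity, by linarith, fun d K u hd hu hint hout hin hmin => ?_⟩
  have htd : 0 < t * d := by positivity
  have htd' : t * d < d := by nlinarith
  have huniv : Ω ≠ univ := by
    rintro rfl
    exact NormedSpace.unbounded_univ ℝ (E n) hΩb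
  refine ae_le_of_energy_le hn hs hΩ hΩb.measure_lt_top.ne hu hint htd htd'.le hout ?_ (ht d hd)
    hmin
  filter_upwards [hin] with x hx hxΩ hKx
  have hsd : -(t / 2 * d) ≤ signedDist Ω x := not_lt.1 fun h => (hx h).not_gt hKx
  rw [signedDist, Metric.infDist_zero_of_mem hxΩ] at hsd
  obtain ⟨z, hz, hxz⟩ := exists_mem_frontier_infDist_compl_eq_dist hxΩ huniv
  obtain ⟨w, hw⟩ := hball z hz (t / 2 * d) (by positivity)
  calc ENNReal.ofReal (unitVol n * (κ / 2) ^ n * (t * d) ^ n)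
      = volume (Metric.ball w (κ * (t / 2 * d))) := by
        rw [volume_ball_eq w (by positivity), mul_assoc, ← mul_pow]
        congr 3; ring
    _ ≤ volume (Metric.closedBall x (t * d) ∩ {y | u y ≤ K - d}) := by
        refine measure_mono_ae ?_
        filter_upwards [hout] with y hy hyw
        obtain ⟨hyz, hyΩ⟩ := hw hyw
        have hyx : dist y x ≤ t * d := by
          rw [Metric.mem_ball] at hyz
          have := dist_triangle y z x
          rw [dist_comm z x] at this
          linarith
        exact ⟨hyx, hy hyΩ ((Metric.infDist_le_dist_of_mem hxΩ).trans_lt (hyx.trans_lt htd'))⟩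

/-! ### Truncations as competitors in the obstacle problem -/

lemma aemeasurable_of_mem_WObst {Ω A : Set (E n)} (hΩ : IsOpen Ω) {φ ψ u : E n → ℝ}
    (hφ : AEMeasurable φ) (hu : u ∈ WObst s Ω A φ ψ) : AEMeasurable u := by
  have h1 : AEMeasurable u (volume.restrict Ω) := hu.1.1.aemeasurable
  have h2 : AEMeasurable u (volume.restrict Ωᶜ) := by
    refine hφ.restrict.congr ?_
    filter_upwards [ae_restrict_mem hΩ.measurableSet.compl] with x hx
    exact (hu.2.1 x hx).symm
  have h := aemeasurable_union_iff.2 ⟨h1, h2⟩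
  rwa [union_compl_self, Measure.restrict_univ] at h

lemma mem_W_neg {Ω : Set (E n)} {u : E n → ℝ} (hu : u ∈ W s Ω) : -u ∈ W s Ω := by
  refine ⟨hu.1.neg, ?_⟩
  have h : gagliardo s Ω (-u) = gagliardo s Ω u := by
    simp only [gagliardo, Pi.neg_apply, neg_sub_neg, abs_sub_comm]
  rw [h]
  exact hu.2

lemma truncAbove_mem_W {Ω : Set (E n)} (hΩ : IsOpen Ω) (hΩf : volume Ω ≠ ⊤) {u : E n → ℝ}
    (hu : u ∈ W s Ω) (K : ℝ) : truncAbove Ω K u ∈ W s Ω := by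
  have hΩm := hΩ.measurableSet
  constructor
  · have hmin : IntegrableOn (fun x => min (u x) K) Ω :=
      Integrable.inf hu.1 (integrableOn_const hΩf)
    refine hmin.congr ?_
    filter_upwards [ae_restrict_mem hΩm] with x hx
    exact (truncAbove_of_mem hx).symm
  · refine lt_of_le_of_lt ?_ hu.2
    refine setLIntegral_mono' hΩm fun x hx => setLIntegral_mono' hΩm fun y hy => ?_
    refine ENNReal.ofReal_le_ofReal ?_
    exact div_le_div_of_nonneg_right (abs_truncAbove_sub_le hx hy) (by positivity)

lemma SolvesObstacle.lintegral_densityDrop_le {Ω A : Set (E n)} (hΩ : IsOpen Ω)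
    {φ ψ u v : E n → ℝ} (hu : SolvesObstacle s Ω A φ ψ u) (hv : v ∈ WObst s Ω A φ ψ) :
    ∫⁻ p, densityDrop s Ω u v p ≤ ∫⁻ p, densityDrop s Ω v u p := by
  have hQ := measurableSet_Q hΩ.measurableSet
  simpa only [densityDrop, lintegral_indicator hQ] using hu.2 v hv

/-- Truncation from above is admissible above the essential supremum of the obstacle. -/
lemma SolvesObstacle.truncMinimal {Ω A : Set (E n)} (hΩ : IsOpen Ω) (hΩf : volume Ω ≠ ⊤)
    (hA : A ⊆ Ω) {φ ψ u : E n → ℝ} (hu : SolvesObstacle s Ω A φ ψ u) {K : ℝ}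
    (hK : ∀ᵐ x ∂(volume.restrict A), ψ x ≤ K) (hAm : MeasurableSet A) :
    TruncMinimal s Ω K u := by
  refine hu.lintegral_densityDrop_le hΩ ⟨truncAbove_mem_W hΩ hΩf hu.1.1 K, fun x hx => ?_, ?_⟩
  · rw [truncAbove_of_notMem hx, hu.1.2.1 x hx]
  · filter_upwards [hK, hu.1.2.2, ae_restrict_mem hAm] with x h1 h2 hx
    rw [truncAbove_of_mem (hA hx)]
    exact le_min h2 h1

/-- Truncation from below raises `u`, so it is admissible at every height. -/
lemma SolvesObstacle.truncMinimal_neg {Ω A : Set (E n)} (hΩ : IsOpen Ω) (hΩf : volume Ω ≠ ⊤)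
    {φ ψ u : E n → ℝ} (hu : SolvesObstacle s Ω A φ ψ u) (K : ℝ) :
    TruncMinimal s Ω K (-u) := by
  have hv : -truncAbove Ω K (-u) ∈ WObst s Ω A φ ψ := by
    refine ⟨mem_W_neg (truncAbove_mem_W hΩ hΩf (mem_W_neg hu.1.1) K), fun x hx => ?_, ?_⟩
    · rw [Pi.neg_apply, truncAbove_of_notMem hx, Pi.neg_apply, neg_neg, hu.1.2.1 x hx]
    · filter_upwards [hu.1.2.2] with x hx
      refine hx.trans ?_
      rw [Pi.neg_apply, le_neg]
      by_cases h : x ∈ Ω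
      · rw [truncAbove_of_mem h]
        exact min_le_left _ _
      · rw [truncAbove_of_notMem h, Pi.neg_apply]
  have h := hu.lintegral_densityDrop_le hΩ hv
  have hneg : ∀ w w' : E n → ℝ, densityDrop s Ω (-w) (-w') = densityDrop s Ω w w' := by
    intro w w'
    simp only [densityDrop, areaDensity_neg]
  rw [← hneg u, ← hneg _ u, neg_neg] at h
  exact h

/-! ### Essential suprema and neighbourhoods -/

lemma ae_abs_le_of_supNorm_le {f : E n → ℝ} {S : Set (E n)} (hS : MeasurableSet S) {M : ℝ≥0∞}
    (h : supNorm f S ≤ M) (hM : M ≠ ⊤) : ∀ᵐ x : E n, x ∈ S → |f x| ≤ M.toReal := by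
  rw [supNorm, eLpNorm_exponent_top] at h
  rw [← ae_restrict_iff' hS]
  filter_upwards [ae_le_eLpNormEssSup (f := f) (μ := volume.restrict S)] with x hx
  have := ENNReal.toReal_mono hM (hx.trans h)
  rwa [toReal_enorm] at this

lemma supNorm_le_ofReal {f : E n → ℝ} {S : Set (E n)} (hS : MeasurableSet S) {C : ℝ}
    (h : ∀ᵐ x : E n, x ∈ S → |f x| ≤ C) : supNorm f S ≤ ENNReal.ofReal C := by
  rw [supNorm, eLpNorm_exponent_top]
  exact eLpNormEssSup_le_of_ae_bound ((ae_restrict_iff' hS).2 h)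

lemma measurableSet_nbhd (Ω : Set (E n)) (δ : ℝ) : MeasurableSet (nbhd Ω δ) :=
  measurableSet_lt (continuous_signedDist Ω).measurable measurable_const

lemma mem_nbhd_of_infDist_lt {Ω : Set (E n)} {x : E n} {δ : ℝ} (h : Metric.infDist x Ω < δ) :
    x ∈ nbhd Ω δ := by
  have h0 : 0 ≤ Metric.infDist x Ωᶜ := Metric.infDist_nonneg
  change signedDist Ω x < δ
  rw [signedDist]
  linarith

end NonlocalObstacle

/-! ### The estimate in the boundary layer -/

open NonlocalObstacle in
theorem proposition2p8 (n : ℕ) (hn : 1 ≤ n) (s : ℝ) (hs0 : 0 < s) (hs1 : s < 1)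
    (Ω : Set (NonlocalObstacle.E n)) (hΩ : IsOpen Ω) (hΩb : Bornology.IsBounded Ω)
    (hΩL : NonlocalObstacle.HasLipschitzBoundary Ω) :
    ∃ θ : ℝ, 0 < θ ∧ θ < 1 ∧
      ∀ (A : Set (NonlocalObstacle.E n)) (φ ψ u : NonlocalObstacle.E n → ℝ) (d : ℝ),
        IsOpen A → A ⊆ Ω →
        MemLp ψ ⊤ (volume.restrict A) →
        AEMeasurable φ volume →
        NonlocalObstacle.SolvesObstacle s Ω A φ ψ u →
        0 < d →
        MemLp φ ⊤ (volume.restrict (NonlocalObstacle.nbhd Ω d \ Ω)) →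
        MemLp u ⊤ (volume.restrict Ω) ∧
          NonlocalObstacle.supNorm u (Ω \ NonlocalObstacle.nbhd Ω (-(θ * d))) ≤
            ENNReal.ofReal d +
              max (NonlocalObstacle.supNorm u (NonlocalObstacle.nbhd Ω (-(θ * d))))
                (max (NonlocalObstacle.supNorm ψ A)
                  (NonlocalObstacle.supNorm φ (NonlocalObstacle.nbhd Ω d \ Ω))) := by
  obtain ⟨θ, hθ0, hθ1, hθ⟩ := exists_layer_width hn hs0 hΩ hΩb hΩL
  refine ⟨θ, hθ0, hθ1, fun A φ ψ u d hA hAΩ hψ hφ hu hd hφd => ?_⟩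
  have hΩf : volume Ω ≠ ⊤ := hΩb.measure_lt_top.ne
  have hum := aemeasurable_of_mem_WObst hΩ hφ hu.1
  have hint : IntegrableOn u Ω := hu.1.1.1
  have hout : ∀ M : ℝ≥0∞, M ≠ ⊤ → supNorm φ (nbhd Ω d \ Ω) ≤ M →
      ∀ᵐ y : E n, y ∈ Ωᶜ → Metric.infDist y Ω < d → |u y| ≤ M.toReal := by
    intro M hM hle
    filter_upwards [ae_abs_le_of_supNorm_le
      ((measurableSet_nbhd Ω d).diff hΩ.measurableSet) hle hM] with y hy hyΩ hyd
    rw [hu.1.2.1 y hyΩ]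
    exact hy ⟨mem_nbhd_of_infDist_lt hyd, hyΩ⟩
  have hψK : ∀ M : ℝ≥0∞, M ≠ ⊤ → supNorm ψ A ≤ M → ∀ K, M.toReal ≤ K →
      TruncMinimal s Ω K u := by
    intro M hM hle K hK
    refine hu.truncMinimal hΩ hΩf hAΩ ?_ hA.measurableSet
    filter_upwards [(ae_restrict_iff' hA.measurableSet).2
      (ae_abs_le_of_supNorm_le hA.measurableSet hle hM)] with x hx
    exact (le_abs_self _).trans (hx.trans hK)
  constructor
  · obtain ⟨K₁, hK₁⟩ := exists_ae_le hn hs0 hΩ hΩf hum hint hd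
      (by
        filter_upwards [hout _ hφd.2.ne le_rfl] with y hy h1 h2
          using (abs_le.1 (hy h1 h2)).2)
      (hψK _ hψ.2.ne le_rfl)
    obtain ⟨K₂, hK₂⟩ := exists_ae_le (u := -u) (K₀ := 0) hn hs0 hΩ hΩf hum.neg hint.neg hd
      (by
        filter_upwards [hout _ hφd.2.ne le_rfl] with y hy h1 h2
          using neg_le.1 (abs_le.1 (hy h1 h2)).1)
      (fun K _ => hu.truncMinimal_neg hΩ hΩf K)
    refine memLp_top_of_bound hint.aestronglyMeasurable (max K₁ K₂)
      ((ae_restrict_iff' hΩ.measurableSet).2 ?_)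
    filter_upwards [hK₁, hK₂] with x h1 h2 hx
    exact abs_le'.2 ⟨(h1 hx).trans (le_max_left _ _), (h2 hx).trans (le_max_right _ _)⟩
  · set M := max (supNorm u (nbhd Ω (-(θ * d)))) (max (supNorm ψ A) (supNorm φ (nbhd Ω d \ Ω)))
      with hMdef
    rcases eq_or_ne M ⊤ with hM | hM
    · simp [hM]
    have hN : 0 ≤ M.toReal := ENNReal.toReal_nonneg
    set K : ℝ := d + M.toReal with hK
    have hKd : K - d = M.toReal := by rw [hK]; ring
    have hφM := hout M hM ((le_max_right _ _).trans (le_max_right _ _))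
    have huM := ae_abs_le_of_supNorm_le (f := u) (measurableSet_nbhd Ω (-(θ * d)))
      (le_max_left _ _ : _ ≤ M) hM
    have h1 := hθ d K u hd hum hint
      (by
        filter_upwards [hφM] with y hy h1 h2
        rw [hKd]
        exact (abs_le.1 (hy h1 h2)).2)
      (by
        filter_upwards [huM] with x hx hxn
        linarith [(abs_le.1 (hx hxn)).2])
      (hψK M hM ((le_max_left _ _).trans (le_max_right _ _)) K (by linarith))
    have h2 := hθ d K (-u) hd hum.neg hint.neg
      (by
        filter_upwards [hφM] with y hy h1 h2
        rw [hKd]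
        exact neg_le.1 (abs_le.1 (hy h1 h2)).1)
      (by
        filter_upwards [huM] with x hx hxn
        rw [Pi.neg_apply]
        linarith [(abs_le.1 (hx hxn)).1])
      (hu.truncMinimal_neg hΩ hΩf K)
    have hbound : supNorm u (Ω \ nbhd Ω (-(θ * d))) ≤ ENNReal.ofReal K := by
      refine supNorm_le_ofReal (hΩ.measurableSet.diff (measurableSet_nbhd _ _)) ?_
      filter_upwards [h1, h2] with x h1 h2 hx
      exact abs_le'.2 ⟨h1 hx.1, h2 hx.1⟩
    rwa [hK, ENNReal.ofReal_add hd.le hN, ENNReal.ofReal_toReal hM] at hbound
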